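/- Let $\mathscr X$ be a finite non-empty set. For a non-empty set $\mathscr Y$, let $\overline{\mathscr L}(\mathscr Y)$ be the set of all maps $\mathscr Y\to\overline{\mathbb R}=\mathbb R\cup\{-\infty,+\infty\}$, and $\overline{\mathscr L}_b(\mathscr Y)$ the set of those that are bounded below by a real number. An \emph{upper expectation} on $\overline{\mathscr L}(\mathscr Y)$ is a map $\overline{\mathrm E}\colon\overline{\mathscr L}(\mathscr Y)\to\overline{\mathbb R}$ such that (E1) $\overline{\mathrm E}(c)=c$ for all $c\in\mathbb R$; (E2) $\overline{\mathrm E}(f+g)\le\overline{\mathrm E}(f)+\overline{\mathrm E}(g)$ for all $f,g\in\overline{\mathscr L}_b(\mathscr Y)$; (E3) $\overline{\mathrm E}(\lambda f)=\lambda\overline{\mathrm E}(f)$ for all real $\lambda>0$ and all $f\in\overline{\mathscr L}_b(\mathscr Y)$; (E4) $f\le g$ implies $\overline{\mathrm E}(f)\le\overline{\mathrm E}(g)$ for all $f,g\in\overline{\mathscr L}_b(\mathscr Y)$; (E5) $\lim_{n\to\infty}\overline{\mathrm E}(f_n)=\overline{\mathrm E}(\lim_{n\to\infty}f_n)$ for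 every pointwise non-decreasing sequence $(f_n)_{n\ge 0}$ of non-negative elements of $\overline{\mathscr L}_b(\mathscr Y)$. A \emph{situation} is a finite (possibly empty) string of elements of $\mathscr X$; the set of all situations is $\mathscr X^\ast$. Let $\Omega=\mathscr X^{\mathbb N}$ be the set of paths; for $\omega\in\Omega$, let $\omega^n\in\mathscr X^\ast$ be the string of its first $n$ states, and let $\Gamma(s)$ be the set of all paths that start with the string $s$. An \emph{imprecise probabilities tree} assigns to every $s\in\mathscr X^\ast$ an upper expectation $\overline{\mathrm Q}_s$ on $\overline{\mathscr L}(\mathscr X)$. A \emph{bounded below supermartingale} is a map $\mathscr M\colon\mathscr X^\ast\to\overline{\mathbb R}$ that is bounded below by a real number and satisfies $\overline{\mathrm Q}_s(\mathscr M(s\,\cdot))\le\mathscr M(s)$ for all $s\in\mathscr X^\ast$, where $\mathscr M(s\,\cdot)$ is the map $x\mapsto\mathscr M(sx)$ on $\mathscr X$. The \emph{game-theoretic upper expectation} of $f\in\overline{\mathscr L}(\Omega)$ conditional on $s\in\mathscr X^\ast$ is $$\overline{\mathrm E}_{\mathrm V}(f\mid s)=\inf\Big\{\mathscr M(s)\colon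 \mathscr M\text{ is a bounded below supermartingale and }\liminf_{n\to\infty}\mathscr M(\omega^n)\ge f(\omega)\text{ for all }\omega\in\Gamma(s)\Big\}.$$ \textbf{Theorem.} For every imprecise probabilities tree and every situation $s\in\mathscr X^\ast$: (i) for every pointwise non-decreasing sequence $(f_n)_{n\ge 0}$ in $\overline{\mathscr L}_b(\Omega)$ that converges pointwise to a variable $f$ (which then lies in $\overline{\mathscr L}_b(\Omega)$ as well), the limit $\lim_{n\to\infty}\overline{\mathrm E}_{\mathrm V}(f_n\mid s)$ exists in $\overline{\mathbb R}$ and $$\overline{\mathrm E}_{\mathrm V}(f\mid s)=\lim_{n\to\infty}\overline{\mathrm E}_{\mathrm V}(f_n\mid s);$$ (ii) the map $\overline{\mathrm E}_{\mathrm V}(\cdot\mid s)$ is an upper expectation on $\overline{\mathscr L}(\Omega)$, that is, it satisfies (E1)--(E5) with $\mathscr Y=\Omega$. -/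

import Mathlib

open Filter Topology

namespace GameTheoretic

/-- An extended real variable is bounded below when some *real* number bounds it from below. -/
def IsBoundedBelow {Y : Type*} (f : Y → EReal) : Prop :=
  ∃ M : ℝ, ∀ y, (M : EReal) ≤ f y

/-- Upper expectations on the set of all extended real variables on `Y`. All axioms only concern
bounded below variables; for these, the axioms `const` and `mono` exclude the value `⊥`, so that
the ambiguous sum of `⊤` and `⊥` never occurs in `subadd`. -/
structure IsUpperExpectation {Y : Type*} (E : (Y → EReal) → EReal) : Prop where
  const : ∀ c : ℝ, E (fun _ => (c : EReal)) = (c : EReal)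
  subadd : ∀ f g : Y → EReal, IsBoundedBelow f → IsBoundedBelow g →
    E (fun y => f y + g y) ≤ E f + E g
  pos_homog : ∀ c : ℝ, 0 < c → ∀ f : Y → EReal, IsBoundedBelow f →
    E (fun y => (c : EReal) * f y) = (c : EReal) * E f
  mono : ∀ f g : Y → EReal, IsBoundedBelow f → IsBoundedBelow g → (∀ y, f y ≤ g y) → E f ≤ E g
  continuous_of_nonneg : ∀ (f : ℕ → Y → EReal) (f' : Y → EReal),
    (∀ n y, 0 ≤ f n y) → (∀ y, Monotone fun n => f n y) →
    (∀ y, Tendsto (fun n => f n y) atTop (𝓝 (f' y))) →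
    Tendsto (fun n => E (f n)) atTop (𝓝 (E f'))

/-- An imprecise probabilities tree: a local upper expectation on the variables on `X` in every
situation. Situations are finite strings of states, that is, elements of `List X`; the initial
situation is `[]` and the situation `s x` is `s ++ [x]`. -/
structure ImpreciseProbabilityTree (X : Type*) where
  localUpper : List X → (X → EReal) → EReal
  isUpperExpectation : ∀ s : List X, IsUpperExpectation (localUpper s)

/-- The situation that consists of the first `n` states of the path `ω`
(the states of a path are numbered from `0` on). -/
def pathPrefix {X : Type*} (ω : ℕ → X) (n : ℕ) : List X :=
  (List.range n).map ω

/-- The cylinder event of all paths that go through the situation `s`. -/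
def cylinder {X : Type*} (s : List X) : Set (ℕ → X) :=
  {ω | pathPrefix ω s.length = s}

/-- The global variable `ω ↦ liminf P(ω^n)` of an extended real process `P`. -/
noncomputable def processLiminf {X : Type*} (P : List X → EReal) (ω : ℕ → X) : EReal :=
  liminf (fun n => P (pathPrefix ω n)) atTop

namespace ImpreciseProbabilityTree

/-- Supermartingales: extended real processes that are locally expected not to increase. -/
def IsSupermartingale {X : Type*} (T : ImpreciseProbabilityTree X) (P : List X → EReal) : Prop :=
  ∀ s : List X, T.localUpper s (fun x => P (s ++ [x])) ≤ P s

/-- The global game-theoretic upper expectation of the global variable `f`, conditional on `s`: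
the infimum of `P s` over all bounded below supermartingales `P` with `liminf P ≥ f` on the
cylinder event of `s`. -/
noncomputable def globalUpper {X : Type*} (T : ImpreciseProbabilityTree X)
    (f : (ℕ → X) → EReal) (s : List X) : EReal :=
  sInf {a : EReal | ∃ P : List X → EReal, T.IsSupermartingale P ∧ IsBoundedBelow P ∧
    (∀ ω ∈ cylinder s, f ω ≤ processLiminf P ω) ∧ P s = a}

end ImpreciseProbabilityTree

end GameTheoretic

namespace GameTheoretic

/-! The substance is continuity from below for non-negative `f n` increasing to `f'`. The
conditional prices of `f n` form a supermartingale, and by local continuity so does their supremum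
`V`. If `V` hedged `f'`, then its value at `s` would bound the price of `f'`. Lévy's zero-one law
says that the prices of `f n` have liminf at least `f n` outside a null set. The exceptional paths
lie in countably many gap events, with rational `a < b`, and `exists_supermartingale_of_null`
supplies one supermartingale, starting at most at `ε`, that is infinite on all of them. Adding it to
`V` gives a hedge of `f'`. A gap event is null by a stopping argument: `globalUpper_le_of_switch`,
applied twice, improves any uniform bound `c` on its price to `c * a / b`, and this can be iterated.
The other axioms come from operations on supermartingales and from following a path along which a
supermartingale does not increase. -/

lemma EReal.le_of_forall_pos_le_add_real {a b : EReal} (h : ∀ ε : ℝ, 0 < ε → a ≤ b + ε) :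
    a ≤ b := by
  induction b with
  | top => exact le_top
  | bot => simpa using h 1 one_pos
  | coe b =>
    refine EReal.le_of_forall_lt_iff_le.1 fun z hz => ?_
    have hz' : b < z := by exact_mod_cast hz
    refine (h (z - b) (sub_pos.2 hz')).trans (le_of_eq ?_)
    rw [← EReal.coe_add]
    simp

lemma EReal.inv_mul_mul_cancel {c : ℝ} (hc : 0 < c) (x : EReal) :
    ((c⁻¹ : ℝ) : EReal) * (c * x) = x := by
  rw [← mul_assoc, ← EReal.coe_mul, inv_mul_cancel₀ hc.ne', EReal.coe_one, one_mul]

lemma EReal.mul_inv_mul_cancel {c : ℝ} (hc : 0 < c) (x : EReal) :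
    (c : EReal) * ((c⁻¹ : ℝ) * x) = x := by
  rw [← mul_assoc, ← EReal.coe_mul, mul_inv_cancel₀ hc.ne', EReal.coe_one, one_mul]

/-! ### Situations, paths and first entries -/

section Paths

variable {X : Type*}

@[simp] lemma length_pathPrefix (ω : ℕ → X) (n : ℕ) : (pathPrefix ω n).length = n := by
  simp [pathPrefix]

lemma pathPrefix_succ (ω : ℕ → X) (n : ℕ) : pathPrefix ω (n + 1) = pathPrefix ω n ++ [ω n] := by
  simp [pathPrefix, List.range_succ]

lemma pathPrefix_isPrefix (ω : ℕ → X) {m n : ℕ} (h : m ≤ n) :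
    pathPrefix ω m <+: pathPrefix ω n := by
  induction n, h using Nat.le_induction with
  | base => exact List.prefix_refl _
  | succ n _ ih => rw [pathPrefix_succ]; exact ih.trans (List.prefix_append _ _)

lemma eq_pathPrefix_of_isPrefix {ω : ℕ → X} {u : List X} {n : ℕ} (h : u <+: pathPrefix ω n) :
    u = pathPrefix ω u.length := by
  have hl : u.length ≤ n := by simpa using h.length_le
  exact (List.prefix_of_prefix_length_le h (pathPrefix_isPrefix ω hl) (by simp)).eq_of_length
    (by simp)

lemma mem_cylinder_of_isPrefix {ω : ℕ → X} {u : List X} {n : ℕ} (h : u <+: pathPrefix ω n) :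
    ω ∈ cylinder u := (eq_pathPrefix_of_isPrefix h).symm

lemma cylinder_subset_of_isPrefix {s t : List X} (h : s <+: t) : cylinder t ⊆ cylinder s := by
  intro ω hω
  have hω' : pathPrefix ω t.length = t := hω
  exact mem_cylinder_of_isPrefix (n := t.length) (by rwa [hω'])

lemma isPrefix_pathPrefix {ω : ℕ → X} {s : List X} (h : ω ∈ cylinder s) {n : ℕ}
    (hn : s.length ≤ n) : s <+: pathPrefix ω n := by
  have h' : pathPrefix ω s.length = s := h
  have := pathPrefix_isPrefix ω hn
  rwa [h'] at this

/-- In every situation `s` and for every rule `x` choosing the next state, there is a path through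
`s` that follows the rule from there on. -/
lemma exists_path_following (s : List X) (x : List X → X) :
    ∃ ω ∈ cylinder s, ∀ n, s.length ≤ n → ω n = x (pathPrefix ω n) := by
  -- `t k` is the situation reached from `s` after `k` applications of the rule.
  let t : ℕ → List X := fun k => Nat.rec s (fun _ u => u ++ [x u]) k
  let ω : ℕ → X := fun n => if h : n < s.length then s[n] else x (t (n - s.length))
  have h0 : pathPrefix ω s.length = s := by
    apply List.ext_getElem
    · simp
    · intro i h1 h2
      simp [pathPrefix, ω, h2]
  have h1 : ∀ k, pathPrefix ω (s.length + k) = t k := by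
    intro k
    induction k with
    | zero => exact h0
    | succ k ih =>
      rw [← add_assoc, pathPrefix_succ, ih]
      simp [ω, t]
  refine ⟨ω, h0, fun n hn => ?_⟩
  obtain ⟨k, rfl⟩ := Nat.exists_eq_add_of_le hn
  rw [h1]
  simp [ω]

open scoped Classical in
/-- The shortest initial segment of a situation that belongs to `D`, if there is one. -/
noncomputable def firstEntry (D : Set (List X)) (t : List X) : Option (List X) :=
  t.inits.find? fun u => decide (u ∈ D)

open scoped Classical in
lemma firstEntry_append (D : Set (List X)) (t : List X) (x : X) :
    firstEntry D (t ++ [x]) =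
      (firstEntry D t).or (if t ++ [x] ∈ D then some (t ++ [x]) else none) := by
  simp only [firstEntry, List.inits_append, List.find?_append]
  congr 1
  by_cases h : t ++ [x] ∈ D <;> simp [h]

lemma mem_of_firstEntry_eq_some {D : Set (List X)} {t u : List X} (h : firstEntry D t = some u) :
    u ∈ D ∧ u <+: t := by
  refine ⟨by simpa using List.find?_some h, (List.mem_inits _ _).1 (List.mem_of_find?_eq_some h)⟩

lemma firstEntry_eq_none {D : Set (List X)} {t : List X} :
    firstEntry D t = none ↔ ∀ u, u <+: t → u ∉ D := by
  simp [firstEntry, List.find?_eq_none]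

lemma firstEntry_pathPrefix_of_le {D : Set (List X)} {ω : ℕ → X} {u : List X} {m n : ℕ}
    (h : firstEntry D (pathPrefix ω m) = some u) (hn : m ≤ n) :
    firstEntry D (pathPrefix ω n) = some u := by
  induction n, hn using Nat.le_induction with
  | base => exact h
  | succ n _ ih => rw [pathPrefix_succ, firstEntry_append, ih, Option.some_or]

end Paths

lemma IsBoundedBelow.of_nonneg {Y : Type*} {f : Y → EReal} (h : ∀ y, 0 ≤ f y) :
    IsBoundedBelow f := ⟨0, by simpa using h⟩

lemma isBoundedBelow_const {Y : Type*} (c : ℝ) : IsBoundedBelow fun _ : Y => (c : EReal) :=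
  ⟨c, fun _ => le_rfl⟩

lemma IsBoundedBelow.add {Y : Type*} {f g : Y → EReal} (hf : IsBoundedBelow f)
    (hg : IsBoundedBelow g) : IsBoundedBelow fun y => f y + g y := by
  obtain ⟨a, ha⟩ := hf
  obtain ⟨b, hb⟩ := hg
  exact ⟨a + b, fun y => by rw [EReal.coe_add]; exact add_le_add (ha y) (hb y)⟩

lemma IsBoundedBelow.const_mul {Y : Type*} {f : Y → EReal} (hf : IsBoundedBelow f) {c : ℝ}
    (hc : 0 < c) : IsBoundedBelow fun y => (c : EReal) * f y := by
  obtain ⟨a, ha⟩ := hf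
  refine ⟨c * a, fun y => ?_⟩
  rw [EReal.coe_mul]
  exact mul_le_mul_of_nonneg_left (ha y) (by exact_mod_cast hc.le)

lemma IsBoundedBelow.comp {Y Z : Type*} {f : Y → EReal} (hf : IsBoundedBelow f) (φ : Z → Y) :
    IsBoundedBelow fun z => f (φ z) := by
  obtain ⟨a, ha⟩ := hf
  exact ⟨a, fun z => ha _⟩

section Liminf

variable {X : Type*}

lemma processLiminf_le_of_le {P R : List X → EReal} {ω : ℕ → X} (N : ℕ)
    (h : ∀ n, N ≤ n → P (pathPrefix ω n) ≤ R (pathPrefix ω n)) :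
    processLiminf P ω ≤ processLiminf R ω :=
  liminf_le_liminf (eventually_atTop.2 ⟨N, h⟩)

lemma le_processLiminf_of_le {P : List X → EReal} {ω : ℕ → X} {c : EReal} (N : ℕ)
    (h : ∀ n, N ≤ n → c ≤ P (pathPrefix ω n)) : c ≤ processLiminf P ω :=
  le_liminf_of_le (by isBoundedDefault) (eventually_atTop.2 ⟨N, h⟩)

lemma processLiminf_le_const {P : List X → EReal} {ω : ℕ → X} {c : EReal} (N : ℕ)
    (h : ∀ n, N ≤ n → P (pathPrefix ω n) ≤ c) : processLiminf P ω ≤ c :=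
  liminf_le_of_frequently_le' (eventually_atTop.2 ⟨N, h⟩).frequently

lemma add_processLiminf_le {P R : List X → EReal} {ω : ℕ → X} :
    processLiminf P ω + processLiminf R ω ≤ processLiminf (fun t => P t + R t) ω :=
  EReal.le_liminf_add

lemma processLiminf_const_mul {P : List X → EReal} {ω : ℕ → X} {c : ℝ} (hc : 0 < c) :
    processLiminf (fun t => (c : EReal) * P t) ω = c * processLiminf P ω :=
  EReal.liminf_const_mul_of_nonneg_of_ne_top (by exact_mod_cast hc.le) (EReal.coe_ne_top c)

end Liminf

/-! ### Supermartingales and elementary properties of the global price -/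

namespace ImpreciseProbabilityTree

variable {X : Type*} {T : ImpreciseProbabilityTree X}

lemma IsSupermartingale.add {P R : List X → EReal} (hP : T.IsSupermartingale P)
    (hR : T.IsSupermartingale R) (hPb : IsBoundedBelow P) (hRb : IsBoundedBelow R) :
    T.IsSupermartingale fun t => P t + R t := fun t =>
  ((T.isUpperExpectation t).subadd _ _ (hPb.comp _) (hRb.comp _)).trans (add_le_add (hP t) (hR t))

lemma IsSupermartingale.const_mul {P : List X → EReal} (hP : T.IsSupermartingale P)
    (hPb : IsBoundedBelow P) {c : ℝ} (hc : 0 < c) :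
    T.IsSupermartingale fun t => (c : EReal) * P t := fun t => by
  rw [(T.isUpperExpectation t).pos_homog c hc (fun x => P (t ++ [x])) (hPb.comp _)]
  exact mul_le_mul_of_nonneg_left (hP t) (by exact_mod_cast hc.le)

lemma isSupermartingale_const (T : ImpreciseProbabilityTree X) (c : ℝ) :
    T.IsSupermartingale fun _ => (c : EReal) := fun t =>
  ((T.isUpperExpectation t).const c).le

lemma IsSupermartingale.iSup {P : ℕ → List X → EReal} (hP : ∀ n, T.IsSupermartingale (P n))
    (h0 : ∀ n t, 0 ≤ P n t) (hm : ∀ t, Monotone fun n => P n t) :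
    T.IsSupermartingale fun t => ⨆ n, P n t := fun t => by
  refine le_of_tendsto' ((T.isUpperExpectation t).continuous_of_nonneg
    (fun n x => P n (t ++ [x])) _ (fun n x => h0 n _) (fun x => hm _)
    fun x => tendsto_atTop_iSup (hm _)) fun n => ?_
  exact (hP n t).trans (le_iSup (fun n => P n t) n)

/-- A bounded below supermartingale does not increase towards at least one of the children of each
situation. -/
lemma IsSupermartingale.exists_child_le [Finite X] [Nonempty X] {P : List X → EReal}
    (hP : T.IsSupermartingale P) (hPb : IsBoundedBelow P) (t : List X) :
    ∃ x, P (t ++ [x]) ≤ P t := by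
  by_contra! h
  -- Finiteness makes the least child value attained, hence strictly above `P t`; a real number fits
  -- in between, as `const` covers reals only.
  obtain ⟨x₀, hx₀⟩ := Finite.exists_min fun x => P (t ++ [x])
  obtain ⟨r, hr, hr'⟩ := EReal.lt_iff_exists_real_btwn.1 (h x₀)
  have := (T.isUpperExpectation t).mono (fun _ => (r : EReal)) (fun x => P (t ++ [x]))
    (isBoundedBelow_const r) (hPb.comp _) fun x => hr'.le.trans (hx₀ x)
  rw [(T.isUpperExpectation t).const] at this
  exact absurd (this.trans (hP t)) (not_le.2 hr)

/-- Always moving to a child where `P` does not increase yields a path through `s` on which the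
liminf is at most `P s`. -/
lemma IsSupermartingale.le_of_le_processLiminf [Finite X] [Nonempty X] {P : List X → EReal}
    (hP : T.IsSupermartingale P) (hPb : IsBoundedBelow P) {s : List X} {c : EReal}
    (h : ∀ ω ∈ cylinder s, c ≤ processLiminf P ω) : c ≤ P s := by
  choose x hx using hP.exists_child_le hPb
  obtain ⟨ω, hω, hωx⟩ := exists_path_following s x
  refine (h ω hω).trans (processLiminf_le_const s.length fun n hn => ?_)
  induction n, hn using Nat.le_induction with
  | base => exact le_of_eq (congrArg P hω)
  | succ n hn ih =>
    rw [pathPrefix_succ, hωx n hn]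
    exact (hx _).trans ih

lemma globalUpper_le {P : List X → EReal} (hP : T.IsSupermartingale P) (hPb : IsBoundedBelow P)
    {f : (ℕ → X) → EReal} {s : List X} (h : ∀ ω ∈ cylinder s, f ω ≤ processLiminf P ω) :
    T.globalUpper f s ≤ P s :=
  sInf_le ⟨P, hP, hPb, h, rfl⟩

lemma le_globalUpper {f : (ℕ → X) → EReal} {s : List X} {a : EReal}
    (h : ∀ P : List X → EReal, T.IsSupermartingale P → IsBoundedBelow P →
      (∀ ω ∈ cylinder s, f ω ≤ processLiminf P ω) → a ≤ P s) : a ≤ T.globalUpper f s := by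
  refine le_sInf ?_
  rintro _ ⟨P, hP, hPb, hf, rfl⟩
  exact h P hP hPb hf

lemma exists_of_globalUpper_lt {f : (ℕ → X) → EReal} {s : List X} {a : EReal}
    (h : T.globalUpper f s < a) : ∃ P : List X → EReal, T.IsSupermartingale P ∧ IsBoundedBelow P ∧
      (∀ ω ∈ cylinder s, f ω ≤ processLiminf P ω) ∧ P s < a := by
  obtain ⟨_, ⟨P, hP, hPb, hf, rfl⟩, ha⟩ := sInf_lt_iff.1 h
  exact ⟨P, hP, hPb, hf, ha⟩

lemma globalUpper_mono {f g : (ℕ → X) → EReal} {s : List X} (h : ∀ ω ∈ cylinder s, f ω ≤ g ω) :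
    T.globalUpper f s ≤ T.globalUpper g s :=
  le_globalUpper fun _ hP hPb hg => globalUpper_le hP hPb fun ω hω => (h ω hω).trans (hg ω hω)

lemma globalUpper_le_const {f : (ℕ → X) → EReal} {s : List X} {c : ℝ}
    (h : ∀ ω ∈ cylinder s, f ω ≤ c) : T.globalUpper f s ≤ c :=
  globalUpper_le (isSupermartingale_const T c) (isBoundedBelow_const c) fun ω hω =>
    le_processLiminf_of_le 0 fun _ _ => h ω hω

lemma const_le_globalUpper [Finite X] [Nonempty X] {f : (ℕ → X) → EReal} {s : List X} {c : EReal}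
    (h : ∀ ω ∈ cylinder s, c ≤ f ω) : c ≤ T.globalUpper f s :=
  le_globalUpper fun _ hP hPb hf =>
    hP.le_of_le_processLiminf hPb fun ω hω => (h ω hω).trans (hf ω hω)

lemma globalUpper_const [Finite X] [Nonempty X] (c : ℝ) (s : List X) :
    T.globalUpper (fun _ => (c : EReal)) s = c :=
  le_antisymm (globalUpper_le_const fun _ _ => le_rfl) (const_le_globalUpper fun _ _ => le_rfl)

lemma isBoundedBelow_globalUpper [Finite X] [Nonempty X] {f : (ℕ → X) → EReal}
    (hf : IsBoundedBelow f) : IsBoundedBelow (T.globalUpper f) := by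
  obtain ⟨a, ha⟩ := hf
  exact ⟨a, fun s => const_le_globalUpper fun ω _ => ha ω⟩

lemma globalUpper_ne_bot [Finite X] [Nonempty X] {f : (ℕ → X) → EReal}
    (hf : IsBoundedBelow f) (s : List X) : T.globalUpper f s ≠ ⊥ := by
  obtain ⟨a, ha⟩ := isBoundedBelow_globalUpper (T := T) hf
  exact ne_bot_of_le_ne_bot (EReal.coe_ne_bot a) (ha s)

lemma globalUpper_add_le [Finite X] [Nonempty X] {f g : (ℕ → X) → EReal}
    (hf : IsBoundedBelow f) (hg : IsBoundedBelow g) (s : List X) :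
    T.globalUpper (fun ω => f ω + g ω) s ≤ T.globalUpper f s + T.globalUpper g s := by
  refine EReal.le_add_of_forall_gt (.inl (globalUpper_ne_bot hf s))
    (.inr (globalUpper_ne_bot hg s)) fun a ha b hb => ?_
  obtain ⟨P, hP, hPb, hPf, hPa⟩ := exists_of_globalUpper_lt ha
  obtain ⟨R, hR, hRb, hRg, hRb'⟩ := exists_of_globalUpper_lt hb
  refine (globalUpper_le (hP.add hR hPb hRb) (hPb.add hRb) fun ω hω => ?_).trans
    (add_le_add hPa.le hRb'.le)
  exact (add_le_add (hPf ω hω) (hRg ω hω)).trans (add_processLiminf_le)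

lemma globalUpper_const_mul_le {f : (ℕ → X) → EReal} {c : ℝ} (hc : 0 < c) (s : List X) :
    T.globalUpper (fun ω => (c : EReal) * f ω) s ≤ c * T.globalUpper f s := by
  have hc' : (0 : EReal) ≤ c := by exact_mod_cast hc.le
  have key : ((c⁻¹ : ℝ) : EReal) * T.globalUpper (fun ω => (c : EReal) * f ω) s ≤
      T.globalUpper f s := by
    refine le_globalUpper fun P hP hPb hf => ?_
    have := globalUpper_le (s := s) (f := fun ω => (c : EReal) * f ω) (hP.const_mul hPb hc)
      (hPb.const_mul hc) fun ω hω => by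
        rw [processLiminf_const_mul hc]
        exact mul_le_mul_of_nonneg_left (hf ω hω) hc'
    have := mul_le_mul_of_nonneg_left this
      (show (0 : EReal) ≤ ((c⁻¹ : ℝ) : EReal) by exact_mod_cast (inv_pos.2 hc).le)
    rwa [EReal.inv_mul_mul_cancel hc] at this
  have := mul_le_mul_of_nonneg_left key hc'
  rwa [EReal.mul_inv_mul_cancel hc] at this

lemma globalUpper_const_mul {f : (ℕ → X) → EReal} {c : ℝ} (hc : 0 < c) (s : List X) :
    T.globalUpper (fun ω => (c : EReal) * f ω) s = c * T.globalUpper f s := by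
  refine le_antisymm (globalUpper_const_mul_le hc s) ?_
  -- The reverse inequality is the same bound for the factor `c⁻¹` and the variable `c * f`.
  have := globalUpper_const_mul_le (T := T) (f := fun ω => (c : EReal) * f ω) (inv_pos.2 hc) s
  simp only [EReal.inv_mul_mul_cancel hc] at this
  have := mul_le_mul_of_nonneg_left this (show (0 : EReal) ≤ c by exact_mod_cast hc.le)
  rwa [EReal.mul_inv_mul_cancel hc] at this

lemma globalUpper_add_const [Finite X] [Nonempty X] {f : (ℕ → X) → EReal} (hf : IsBoundedBelow f)
    (c : ℝ) (s : List X) :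
    T.globalUpper (fun ω => f ω + c) s = T.globalUpper f s + c := by
  refine le_antisymm ?_ ?_
  · exact (globalUpper_add_le hf (isBoundedBelow_const c) s).trans (by rw [globalUpper_const])
  · have := globalUpper_add_le (T := T) (hf.add (isBoundedBelow_const c))
      (isBoundedBelow_const (-c)) s
    rw [globalUpper_const] at this
    have hc : ∀ x : EReal, x + c + ((-c : ℝ) : EReal) = x := fun x => by
      rw [add_assoc, ← EReal.coe_add, add_neg_cancel, EReal.coe_zero, add_zero]
    simp only [hc] at this
    have := add_le_add_left this (c : EReal)
    rwa [add_assoc, ← EReal.coe_add, neg_add_cancel, EReal.coe_zero, add_zero] at this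

/-- The conditional global upper expectations of a bounded below variable form a supermartingale. -/
lemma isSupermartingale_globalUpper [Finite X] [Nonempty X] {f : (ℕ → X) → EReal}
    (hf : IsBoundedBelow f) : T.IsSupermartingale (T.globalUpper f) := fun t => by
  refine le_globalUpper fun P hP hPb hPf => le_trans ?_ (hP t)
  refine (T.isUpperExpectation t).mono _ _ ((isBoundedBelow_globalUpper hf).comp _) (hPb.comp _)
    fun x => globalUpper_le hP hPb fun ω hω => hPf ω ?_
  exact cylinder_subset_of_isPrefix (List.prefix_append _ _) hω

/-! ### Switching between supermartingales -/

/-- Non-negative variables can be hedged with non-negative supermartingales. -/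
lemma exists_nonneg_of_globalUpper_lt [Finite X] [Nonempty X] {f : (ℕ → X) → EReal}
    (hf : ∀ ω, 0 ≤ f ω) {s : List X} {a : EReal} (h : T.globalUpper f s < a) :
    ∃ P : List X → EReal, T.IsSupermartingale P ∧ (∀ t, 0 ≤ P t) ∧
      (∀ ω ∈ cylinder s, f ω ≤ processLiminf P ω) ∧ P s < a := by
  classical
  obtain ⟨P, hP, hPb, hPf, hPa⟩ := exists_of_globalUpper_lt h
  -- Outside the subtree of `s` the value `⊤` satisfies every requirement; inside, the hedged
  -- variable being non-negative forces `P` to be so.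
  refine ⟨fun t => if s <+: t then P t else ⊤, fun t => ?_, fun t => ?_, fun ω hω => ?_, ?_⟩
  · by_cases ht : s <+: t
    · simpa [ht, ht.trans (List.prefix_append _ _)] using hP t
    · simp [ht]
  · by_cases ht : s <+: t
    · simp only [ht, if_true]
      exact hP.le_of_le_processLiminf hPb fun ω hω =>
        (hf ω).trans (hPf ω (cylinder_subset_of_isPrefix ht hω))
    · simp [ht]
  · refine (hPf ω hω).trans (processLiminf_le_of_le s.length fun n hn => ?_)
    simp [isPrefix_pathPrefix hω hn]
  · simpa using hPa

/-- If a non-negative supermartingale hedges `g` on the paths through `s` that do not enter `D`, and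
covers the price of `g` in all situations of `D`, then it covers the price of `g` in `s`. -/
lemma globalUpper_le_of_switch [Finite X] [Nonempty X] {g : (ℕ → X) → EReal} (hg : ∀ ω, 0 ≤ g ω)
    {P : List X → EReal} (hP : T.IsSupermartingale P) (hP0 : ∀ t, 0 ≤ P t) {s : List X}
    (D : Set (List X)) (hD : ∀ t ∈ D, T.globalUpper g t ≤ P t)
    (hω : ∀ ω ∈ cylinder s, (∀ n, s.length ≤ n → pathPrefix ω n ∉ D) → g ω ≤ processLiminf P ω) :
    T.globalUpper g s ≤ P s := by
  refine EReal.le_of_forall_pos_le_add_real fun ε hε => ?_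
  have hε' : (0 : EReal) ≤ ε := by exact_mod_cast hε.le
  have hN : ∀ u, ∃ N : List X → EReal, T.IsSupermartingale N ∧ (∀ t, 0 ≤ N t) ∧
      (∀ ω ∈ cylinder u, g ω ≤ processLiminf N ω) ∧ (u ∈ D → N u ≤ P u + ε) := by
    intro u
    -- Where `P u = ⊤` there is no strict inequality to exploit, but the constant `⊤` is then an
    -- affordable hedge.
    by_cases hu : u ∈ D ∧ P u ≠ ⊤
    · have : T.globalUpper g u < P u + ε := by
        refine (hD u hu.1).trans_lt ?_
        lift P u to ℝ using ⟨hu.2, ne_bot_of_le_ne_bot EReal.zero_ne_bot (hP0 u)⟩ with p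
        exact_mod_cast lt_add_of_pos_right p hε
      obtain ⟨N, h1, h2, h3, h4⟩ := exists_nonneg_of_globalUpper_lt hg this
      exact ⟨N, h1, h2, h3, fun _ => h4.le⟩
    · refine ⟨fun _ => ⊤, fun _ => le_top, fun _ => le_top, fun ω _ => ?_, fun h => ?_⟩
      · simp [processLiminf]
      · have : P u = ⊤ := by simpa [h] using hu
        simp [this]
  choose N hN1 hN2 hN3 hN4 using hN
  -- Entries strictly before `s` must not trigger the switch.
  let D' : Set (List X) := D ∩ {t | s.length ≤ t.length}
  -- Follow `P + ε` until the first entry `u` into `D'`, then `N u` forever. The switch only lowers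
  -- the value, so the supermartingale property survives; `ε` pays for `N u` being only nearly
  -- optimal.
  let R : List X → EReal := fun t => (firstEntry D' t).elim (P t + ε) fun u => N u t
  have hPε : T.IsSupermartingale fun t => P t + ε :=
    hP.add (isSupermartingale_const T ε) (.of_nonneg hP0) (isBoundedBelow_const ε)
  have hR0 : ∀ t, 0 ≤ R t := fun t => by
    cases h : firstEntry D' t with
    | none => simpa [R, h] using add_nonneg (hP0 t) hε'
    | some u => simpa [R, h] using hN2 u t
  have hR : T.IsSupermartingale R := fun t => by
    cases h : firstEntry D' t with
    | some u => simpa [R, h, firstEntry_append] using hN1 u t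
    | none =>
      refine le_trans ?_ ((hPε t).trans (by simp [R, h]))
      refine (T.isUpperExpectation t).mono _ _ (.of_nonneg fun x => hR0 _)
        (.of_nonneg fun x => add_nonneg (hP0 _) hε') fun x => ?_
      by_cases hx : t ++ [x] ∈ D'
      · simpa [R, h, firstEntry_append, hx] using hN4 _ hx.1
      · simp [R, h, firstEntry_append, hx]
  have hRs : R s ≤ P s + ε := by
    cases h : firstEntry D' s with
    | none => simp [R, h]
    | some u =>
      obtain ⟨hu, hus⟩ := mem_of_firstEntry_eq_some h
      obtain rfl := hus.eq_of_length_le hu.2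
      simpa [R, h] using hN4 _ hu.1
  refine (globalUpper_le hR (.of_nonneg hR0) fun ω hωs => ?_).trans hRs
  by_cases h : ∀ n, s.length ≤ n → pathPrefix ω n ∉ D
  · refine (hω ω hωs h).trans (processLiminf_le_of_le 0 fun n _ => ?_)
    have : firstEntry D' (pathPrefix ω n) = none := by
      refine firstEntry_eq_none.2 fun u hu huD => h u.length huD.2 ?_
      rw [← eq_pathPrefix_of_isPrefix hu]
      exact huD.1
    simpa [R, this] using le_add_of_nonneg_right hε'
  · push Not at h
    obtain ⟨m, hm, hmD⟩ := h
    obtain ⟨u, hu⟩ : ∃ u, firstEntry D' (pathPrefix ω m) = some u := by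
      refine Option.ne_none_iff_exists'.1 fun h => ?_
      exact firstEntry_eq_none.1 h _ (List.prefix_refl _) ⟨hmD, by simpa using hm⟩
    refine (hN3 u ω (mem_cylinder_of_isPrefix (mem_of_firstEntry_eq_some hu).2)).trans
      (processLiminf_le_of_le m fun n hn => ?_)
    simp [R, firstEntry_pathPrefix_of_le hu hn]

/-! ### Lévy's zero-one law and null events -/

/-- The paths along which the conditional global upper expectation of `f` falls below `a` infinitely
often, although `f` itself exceeds `b`. -/
def gapEvent (T : ImpreciseProbabilityTree X) (f : (ℕ → X) → EReal) (a b : ℝ) : Set (ℕ → X) :=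
  {ω | processLiminf (T.globalUpper f) ω < a ∧ (b : EReal) < f ω}

/-- Hold the constant `c / b * a` until the price of `f` drops below `a`; this buys `c / b` units of
a hedge `M` of `f`. Once `M` exceeds `b`, the holding is worth at least `c`, enough for the
indicator. If either stage never ends, the path is outside the gap event. -/
lemma globalUpper_gapEvent_le_mul [Finite X] [Nonempty X] {f : (ℕ → X) → EReal}
    (hf : ∀ ω, 0 ≤ f ω) {a b c : ℝ} (ha : 0 < a) (hb : 0 < b) (hc : 0 < c)
    (h : ∀ t, T.globalUpper ((T.gapEvent f a b).indicator fun _ => 1) t ≤ c) (s : List X) :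
    T.globalUpper ((T.gapEvent f a b).indicator fun _ => 1) s ≤ (c / b * a : ℝ) := by
  have hcb : 0 < c / b := div_pos hc hb
  have hcb' : (0 : EReal) ≤ (c / b : ℝ) := by exact_mod_cast hcb.le
  have hg : ∀ ω, 0 ≤ (T.gapEvent f a b).indicator (fun _ => (1 : EReal)) ω :=
    Set.indicator_nonneg fun _ _ => zero_le_one
  have hK : (0 : EReal) ≤ (c / b * a : ℝ) := by exact_mod_cast (mul_pos hcb ha).le
  refine globalUpper_le_of_switch (P := fun _ => ((c / b * a : ℝ) : EReal)) hg
    (isSupermartingale_const T _) (fun _ => hK) {t | T.globalUpper f t < a} (fun t ht => ?_)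
    fun ω _ hn => ?_
  · obtain ⟨M, hM, hM0, hMf, hMa⟩ := exists_nonneg_of_globalUpper_lt hf ht
    have key := globalUpper_le_of_switch (P := fun t => ((c / b : ℝ) : EReal) * M t) (s := t) hg
      (hM.const_mul (.of_nonneg hM0) hcb) (fun t => mul_nonneg hcb' (hM0 t)) {u | (b : EReal) < M u}
      (fun u hu => ?_) fun ω hω hn => ?_
    · refine key.trans ?_
      rw [EReal.coe_mul]
      exact mul_le_mul_of_nonneg_left hMa.le hcb'
    · refine (h u).trans ?_
      have := mul_le_mul_of_nonneg_left (le_of_lt hu) hcb'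
      rwa [← EReal.coe_mul, div_mul_cancel₀ _ hb.ne'] at this
    · rw [Set.indicator_of_notMem]
      · exact le_processLiminf_of_le 0 fun n _ => mul_nonneg hcb' (hM0 _)
      · rintro ⟨_, hbf⟩
        refine absurd ((hMf ω hω).trans ?_) (not_le.2 hbf)
        exact processLiminf_le_const t.length fun n hl => not_lt.1 (hn n hl)
  · rw [Set.indicator_of_notMem]
    · exact le_processLiminf_of_le 0 fun n _ => hK
    · rintro ⟨hlt, _⟩
      exact absurd (le_processLiminf_of_le s.length fun n hl => not_lt.1 (hn n hl)) (not_le.2 hlt)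

/-- The essential part of Lévy's zero-one law. -/
lemma globalUpper_gapEvent_le_zero [Finite X] [Nonempty X] {f : (ℕ → X) → EReal}
    (hf : ∀ ω, 0 ≤ f ω) {a b : ℝ} (ha : 0 < a) (hab : a < b) (s : List X) :
    T.globalUpper ((T.gapEvent f a b).indicator fun _ => 1) s ≤ 0 := by
  have hb := ha.trans hab
  have hpow : ∀ (k : ℕ) (t : List X),
      T.globalUpper ((T.gapEvent f a b).indicator fun _ => 1) t ≤ ((a / b) ^ k : ℝ) := by
    intro k
    induction k with
    | zero =>
      intro t
      refine globalUpper_le_const fun ω _ => ?_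
      simpa using Set.indicator_le_self' (s := T.gapEvent f a b) (f := fun _ => (1 : EReal))
        (fun _ _ => zero_le_one) ω
    | succ k ih =>
      intro t
      refine (globalUpper_gapEvent_le_mul hf ha hb (by positivity) ih t).trans (le_of_eq ?_)
      congr 1
      rw [pow_succ, div_mul_eq_mul_div, mul_div_assoc]
  have hlim := tendsto_pow_atTop_nhds_zero_of_lt_one (div_pos ha hb).le ((div_lt_one hb).2 hab)
  exact ge_of_tendsto' ((continuous_coe_real_ereal.tendsto 0).comp hlim) fun k => hpow k s

/-- Countably many events of upper probability zero have a common non-negative supermartingale that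
starts arbitrarily small in `s` and becomes infinite on all of them. -/
lemma exists_supermartingale_of_null [Finite X] [Nonempty X] {ι : Type*} [Countable ι]
    {A : ι → Set (ℕ → X)} {s : List X}
    (hA : ∀ i, T.globalUpper ((A i).indicator fun _ => 1) s ≤ 0) {ε : ℝ} (hε : 0 < ε) :
    ∃ P : List X → EReal, T.IsSupermartingale P ∧ (∀ t, 0 ≤ P t) ∧ P s ≤ ε ∧
      ∀ i, ∀ ω ∈ cylinder s, ω ∈ A i → processLiminf P ω = ⊤ := by
  rcases isEmpty_or_nonempty ι with hι | hι
  · exact ⟨fun _ => (ε : EReal), isSupermartingale_const T ε,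
      fun _ => EReal.coe_nonneg.2 hε.le, le_rfl, fun i => isEmptyElim i⟩
  obtain ⟨e, he⟩ := exists_surjective_nat ι
  -- Unpairing `k` makes each event recur for arbitrarily large payoffs `k`, at costs with total at
  -- most `ε`. The factor `k + 1` keeps the scaling positive at `k = 0`.
  have hN : ∀ k : ℕ, ∃ N : List X → EReal, T.IsSupermartingale N ∧ (∀ t, 0 ≤ N t) ∧
      (∀ ω ∈ cylinder s, ω ∈ A (e k.unpair.1) → (k : EReal) ≤ processLiminf N ω) ∧
      N s < (ε * (1 / 2) ^ (k + 1) : ℝ) := by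
    intro k
    have hk : (0 : ℝ) < k + 1 := by positivity
    have hk' : (0 : EReal) ≤ (k + 1 : ℝ) := by exact_mod_cast hk.le
    have hlt : T.globalUpper (fun ω => ((k + 1 : ℝ) : EReal) *
        (A (e k.unpair.1)).indicator (fun _ => 1) ω) s < (ε * (1 / 2) ^ (k + 1) : ℝ) := by
      rw [globalUpper_const_mul hk]
      refine (mul_le_mul_of_nonneg_left (hA _) hk').trans_lt ?_
      rw [mul_zero]
      exact_mod_cast (by positivity : 0 < ε * (1 / 2) ^ (k + 1))
    obtain ⟨N, h1, h2, h3, h4⟩ := exists_nonneg_of_globalUpper_lt (fun ω => mul_nonneg hk'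
      (Set.indicator_nonneg (fun _ _ => zero_le_one) ω)) hlt
    refine ⟨N, h1, h2, fun ω hω hωA => le_trans ?_ (h3 ω hω), h4⟩
    rw [Set.indicator_of_mem hωA, mul_one]
    exact_mod_cast (by linarith : (k : ℝ) ≤ k + 1)
  choose N hN1 hN2 hN3 hN4 using hN
  let S : ℕ → List X → EReal := fun n t => ∑ k ∈ Finset.range n, N k t
  have hS0 : ∀ n t, 0 ≤ S n t := fun n t => Finset.sum_nonneg fun k _ => hN2 k t
  have hSm : ∀ t, Monotone fun n => S n t := fun t => monotone_nat_of_le_succ fun n => by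
    simp only [S, Finset.sum_range_succ]
    exact le_add_of_nonneg_right (hN2 n t)
  have hS : ∀ n, T.IsSupermartingale (S n) := by
    intro n
    induction n with
    | zero => simpa [S] using isSupermartingale_const T 0
    | succ n ih =>
      simpa only [S, Finset.sum_range_succ] using
        ih.add (hN1 n) (.of_nonneg (hS0 n)) (.of_nonneg (hN2 n))
  refine ⟨fun t => ⨆ n, S n t, IsSupermartingale.iSup hS hS0 hSm,
    fun t => (hS0 0 t).trans (le_iSup (fun n => S n t) 0), iSup_le fun n => ?_,
    fun i ω hω hωA => ?_⟩
  · have : S n s ≤ (ε * (1 - (1 / 2) ^ n) : ℝ) := by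
      induction n with
      | zero => simp [S]
      | succ n ih =>
        simp only [S, Finset.sum_range_succ]
        refine (add_le_add ih (hN4 n).le).trans (le_of_eq ?_)
        rw [← EReal.coe_add]
        congr 1
        ring
    refine this.trans ?_
    have h2 : (0 : ℝ) < (1 / 2) ^ n := by positivity
    exact_mod_cast (by nlinarith : ε * (1 - (1 / 2) ^ n) ≤ ε)
  · obtain ⟨m, rfl⟩ := he i
    refine EReal.eq_top_iff_forall_lt _ |>.2 fun y => ?_
    obtain ⟨j, hj⟩ := exists_nat_gt y
    -- The single summand with index `Nat.pair m j` already pays more than `y` on this event.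
    refine lt_of_lt_of_le (b := ((Nat.pair m j : ℕ) : EReal)) ?_
      ((hN3 (Nat.pair m j) ω hω (by simpa using hωA)).trans
        (processLiminf_le_of_le 0 fun n _ => ?_))
    · have : (j : ℝ) ≤ (Nat.pair m j : ℕ) := by exact_mod_cast Nat.right_le_pair m j
      exact_mod_cast hj.trans_le this
    · refine le_trans ?_ (le_iSup (fun n => S n _) (Nat.pair m j + 1))
      simp only [S, Finset.sum_range_succ]
      exact le_add_of_nonneg_left (hS0 _ _)

/-! ### Continuity from below -/

lemma tendsto_globalUpper_of_nonneg [Finite X] [Nonempty X] {f : ℕ → (ℕ → X) → EReal}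
    {f' : (ℕ → X) → EReal} (hf : ∀ n ω, 0 ≤ f n ω) (hm : ∀ ω, Monotone fun n => f n ω)
    (hlim : ∀ ω, Tendsto (fun n => f n ω) atTop (𝓝 (f' ω))) (s : List X) :
    Tendsto (fun n => T.globalUpper (f n) s) atTop (𝓝 (T.globalUpper f' s)) := by
  have hVm : ∀ t, Monotone fun n => T.globalUpper (f n) t := fun t m n hmn =>
    globalUpper_mono fun ω _ => hm ω hmn
  have hV0 : ∀ n t, 0 ≤ T.globalUpper (f n) t := fun n t =>
    const_le_globalUpper fun ω _ => hf n ω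
  have hV : T.IsSupermartingale fun t => ⨆ n, T.globalUpper (f n) t :=
    IsSupermartingale.iSup (fun n => isSupermartingale_globalUpper (.of_nonneg (hf n))) hV0 hVm
  have hVb : ∀ t, 0 ≤ ⨆ n, T.globalUpper (f n) t := fun t =>
    (hV0 0 t).trans (le_iSup (fun n => T.globalUpper (f n) t) 0)
  suffices h : T.globalUpper f' s = ⨆ n, T.globalUpper (f n) s by
    rw [h]
    exact tendsto_atTop_iSup (hVm s)
  refine le_antisymm ?_ (iSup_le fun n => globalUpper_mono fun ω _ => (hm ω).ge_of_tendsto (hlim ω) n)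
  refine EReal.le_of_forall_pos_le_add_real fun ε hε => ?_
  let ι := {p : ℕ × ℚ × ℚ // 0 < p.2.1 ∧ p.2.1 < p.2.2}
  obtain ⟨P, hP, hP0, hPs, hPA⟩ := exists_supermartingale_of_null (T := T) (s := s) (ι := ι)
    (A := fun i => T.gapEvent (f i.1.1) i.1.2.1 i.1.2.2)
    (fun i => globalUpper_gapEvent_le_zero (hf _) (by exact_mod_cast i.2.1)
      (by exact_mod_cast i.2.2) s) hε
  refine (globalUpper_le (hV.add hP (.of_nonneg hVb) (.of_nonneg hP0))
    ((IsBoundedBelow.of_nonneg hVb).add (.of_nonneg hP0)) fun ω hω => ?_).trans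
    (add_le_add le_rfl hPs)
  by_cases hA : ∃ i : ι, ω ∈ T.gapEvent (f i.1.1) i.1.2.1 i.1.2.2
  · obtain ⟨i, hi⟩ := hA
    refine le_top.trans ((hPA i ω hω hi).symm.le.trans (processLiminf_le_of_le 0 fun n _ => ?_))
    exact le_add_of_nonneg_left (hVb _)
  · refine le_of_tendsto' (hlim ω) fun n => ?_
    have hn : f n ω ≤ processLiminf (T.globalUpper (f n)) ω := by
      by_contra! hlt
      obtain ⟨a, ha, ha'⟩ := EReal.lt_iff_exists_rat_btwn.1 hlt
      obtain ⟨b, hb, hb'⟩ := EReal.lt_iff_exists_rat_btwn.1 ha'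
      -- Non-negative prices put `a` above zero, as the bound on gap events requires.
      have ha0 : (0 : EReal) < ((a : ℝ) : EReal) :=
        (le_processLiminf_of_le 0 fun k _ => hV0 n _).trans_lt ha
      exact hA ⟨⟨(n, a, b), by exact_mod_cast ha0, by exact_mod_cast hb⟩, ha, hb'⟩
    refine hn.trans (processLiminf_le_of_le 0 fun k _ => ?_)
    exact (le_iSup (fun n => T.globalUpper (f n) _) n).trans (le_add_of_nonneg_right (hP0 _))

lemma tendsto_globalUpper [Finite X] [Nonempty X] {f : ℕ → (ℕ → X) → EReal}
    {f' : (ℕ → X) → EReal} (hf : ∀ n, IsBoundedBelow (f n)) (hm : ∀ ω, Monotone fun n => f n ω)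
    (hlim : ∀ ω, Tendsto (fun n => f n ω) atTop (𝓝 (f' ω))) (s : List X) :
    Tendsto (fun n => T.globalUpper (f n) s) atTop (𝓝 (T.globalUpper f' s)) := by
  obtain ⟨a, ha⟩ := hf 0
  have ha' : ∀ n ω, (a : EReal) ≤ f n ω := fun n ω => (ha ω).trans (hm ω (Nat.zero_le n))
  have hc : ∀ x : EReal, x + ((-a : ℝ) : EReal) + a = x := fun x => by
    rw [add_assoc, ← EReal.coe_add, neg_add_cancel, EReal.coe_zero, add_zero]
  have hb : IsBoundedBelow f' := ⟨a, fun ω => ge_of_tendsto' (hlim ω) fun n => ha' n ω⟩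
  have hadd : ∀ c : ℝ, Continuous fun x : EReal => x + c := fun c =>
    continuous_iff_continuousAt.2 fun x =>
      (EReal.continuousAt_add (.inr (EReal.coe_ne_bot c)) (.inr (EReal.coe_ne_top c))).comp
        (f := fun x => (x, (c : EReal))) (by fun_prop)
  -- Monotonicity makes the lower bound `a` of `f 0` uniform in `n`; subtracting it reduces to the
  -- non-negative case.
  have key := tendsto_globalUpper_of_nonneg (T := T) (f := fun n ω => f n ω + ((-a : ℝ) : EReal))
    (f' := fun ω => f' ω + ((-a : ℝ) : EReal)) (fun n ω => ?_)
    (fun ω m n hmn => add_le_add (hm ω hmn) le_rfl)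
    (fun ω => ((hadd (-a)).tendsto _).comp (hlim ω)) s
  · have := ((hadd a).tendsto _).comp key
    simpa only [Function.comp_def, globalUpper_add_const (hf _), globalUpper_add_const hb, hc]
      using this
  · have := add_le_add (ha' n ω) (le_refl ((-a : ℝ) : EReal))
    rwa [← EReal.coe_add, add_neg_cancel, EReal.coe_zero] at this

end ImpreciseProbabilityTree

end GameTheoretic

theorem mainTheorem3 {X : Type*} [Finite X] [Nonempty X]
    (T : GameTheoretic.ImpreciseProbabilityTree X) (s : List X) :
    (∀ (f : ℕ → (ℕ → X) → EReal) (f' : (ℕ → X) → EReal),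
      (∀ n, GameTheoretic.IsBoundedBelow (f n)) →
      (∀ ω, Monotone fun n => f n ω) →
      (∀ ω, Tendsto (fun n => f n ω) atTop (𝓝 (f' ω))) →
      Tendsto (fun n => T.globalUpper (f n) s) atTop (𝓝 (T.globalUpper f' s))) ∧
    GameTheoretic.IsUpperExpectation (fun f : (ℕ → X) → EReal => T.globalUpper f s) := by
  refine ⟨fun f f' hf hm hlim => GameTheoretic.ImpreciseProbabilityTree.tendsto_globalUpper
    hf hm hlim s, ?_⟩
  exact
    { const := fun c => GameTheoretic.ImpreciseProbabilityTree.globalUpper_const c s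
      subadd := fun f g hf hg =>
        GameTheoretic.ImpreciseProbabilityTree.globalUpper_add_le hf hg s
      pos_homog := fun c hc f _ =>
        GameTheoretic.ImpreciseProbabilityTree.globalUpper_const_mul hc s
      mono := fun f g _ _ h =>
        GameTheoretic.ImpreciseProbabilityTree.globalUpper_mono fun ω _ => h ω
      continuous_of_nonneg := fun f f' hf hm hlim =>
        GameTheoretic.ImpreciseProbabilityTree.tendsto_globalUpper_of_nonneg hf hm hlim s }
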